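/- Identify $x\in X=\mathrm{SL}(3,\mathbb R)$ (with columns $x_1,x_2,x_3$) with the tetrahedron with vertices $x_0=0,x_1,x_2,x_3\in\mathbb R^3$. Let $\Delta_0=(x_0,x_1,x_3)$, $\Delta_1=(x_1,x_2,x_3)$, $\Delta_2=(x_2,x_0,x_3)$, $\Delta_3=(x_0,x_1,x_2)$ be its ordered faces; write $\Delta_i=(x_{i_0},x_{i_1},x_{i_2})$, and let $c_i$ be the centroid of $\Delta_i$. For $j\in\{0,1,2\}$ (indices $j-1$ modulo $3$, Euclidean norm) put $$\theta_{ij}=\|x_{i_{j-1}}-c_i\|\,\|x_{i_j}-c_i\|^{-1}(x_{i_j}-c_i)+c_i .$$ Put $$y_0=\tfrac13(\theta_{00}+\theta_{21}+\theta_{30}),\quad y_1=\tfrac13(\theta_{01}+\theta_{10}+\theta_{31}),\quad y_2=\tfrac13(\theta_{11}+\theta_{20}+\theta_{32}),\quad y_3=\tfrac13(\theta_{02}+\theta_{12}+\theta_{22}),$$ let $\tilde\Theta(x)$ be the matrix with columns $y_1-y_0,\ y_2-y_0,\ y_3-y_0$, and let $$\Theta(x)=\left(\frac{\det x}{\det\tilde\Theta(x)}\right)^{1/3}\tilde\Theta(x),$$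 which is a map $\Theta: X\to X$ (one has $\det\tilde\Theta(x)>0$ for $x\in X$). A compact set $\mathcal A\subset X$ with $\Theta(\mathcal A)\subset\mathcal A$ is called a local attractor of the continuous map $\Theta$ if there is an open set $U\supset\mathcal A$ with $\Theta(U)\subset U$ and $\bigcap_{n\ge 0}\Theta^n(U)=\mathcal A$. **Lemma.** Let $x_{eq}\in\mathrm{SL}(3,\mathbb R)$ be a regular tetrahedron (all six edges have the same length), and let $\mathcal A=\mathrm{SO}(3)\,x_{eq}=\{\rho x_{eq}:\rho\in \mathrm{SO}(3)\}$. Then $\Theta$ is continuous on $X$, and $\mathcal A$ is a local attractor of $\Theta$ and a $3$-dimensional smooth submanifold. Moreover: 1. $\Theta(\mathcal A)=\mathcal A$; 2. there is an open neighbourhood $U\subset\mathrm{SL}(3,\mathbb R)$ of $\mathcal A$ such that for every $x\in U$ the iterates $\Theta^n(x)$ converge, as $n\to\infty$, to a single regular tetrahedron $x^*\in\mathcal A$. -/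

import Mathlib

open scoped ContDiff

namespace Tetra

/-- The Euclidean space `ℝ³`. -/
abbrev Pt : Type := EuclideanSpace ℝ (Fin 3)

/-- The space of tetrahedra `X = SL(3, ℝ)`: the matrix `x` with columns `x₁, x₂, x₃` stands for the
tetrahedron with vertices `0, x₁, x₂, x₃`. It carries the topology induced from the matrices. -/
abbrev Tet : Type := Matrix.SpecialLinearGroup (Fin 3) ℝ

/-- The `k`-th column of a matrix, as a point of Euclidean space. -/
noncomputable def column (x : Matrix (Fin 3) (Fin 3) ℝ) (k : Fin 3) : Pt :=
  WithLp.toLp 2 (fun i => x i k)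

/-- The four vertices `x₀ = 0, x₁, x₂, x₃` of the tetrahedron given by a matrix. -/
noncomputable def vertex (x : Matrix (Fin 3) (Fin 3) ℝ) : Fin 4 → Pt :=
  ![0, column x 0, column x 1, column x 2]

/-- The four (ordered) faces `Δ₀ = (x₀, x₁, x₃)`, `Δ₁ = (x₁, x₂, x₃)`, `Δ₂ = (x₂, x₀, x₃)`,
`Δ₃ = (x₀, x₁, x₂)`, given by the indices of their vertices. -/
def face : Fin 4 → Fin 3 → Fin 4 :=
  ![![0, 1, 3], ![1, 2, 3], ![2, 0, 3], ![0, 1, 2]]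

/-- The centroid `cᵢ` of the face `Δᵢ`. -/
noncomputable def centroid (x : Matrix (Fin 3) (Fin 3) ℝ) (i : Fin 4) : Pt :=
  (1 / 3 : ℝ) • ∑ j, vertex x (face i j)

/-- The ratio `‖x_{i_{j-1}} - cᵢ‖ ‖x_{i_j} - cᵢ‖⁻¹`; the index `j - 1` is taken modulo `3`. -/
noncomputable def ratio (x : Matrix (Fin 3) (Fin 3) ℝ) (i : Fin 4) (j : Fin 3) : ℝ :=
  ‖vertex x (face i (j - 1)) - centroid x i‖ * ‖vertex x (face i j) - centroid x i‖⁻¹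

/-- The pseudo-rotation of the face `Δᵢ`: the point `θᵢⱼ(Δᵢ)`. -/
noncomputable def pseudoRot (x : Matrix (Fin 3) (Fin 3) ℝ) (i : Fin 4) (j : Fin 3) : Pt :=
  ratio x i j • (vertex x (face i j) - centroid x i) + centroid x i

/-- The new vertices: each vertex is sent to the barycentre of its three images under the
pseudo-rotations of the three faces that contain it. -/
noncomputable def newVertex (x : Matrix (Fin 3) (Fin 3) ℝ) : Fin 4 → Pt :=
  ![(1 / 3 : ℝ) • (pseudoRot x 0 0 + pseudoRot x 2 1 + pseudoRot x 3 0),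
    (1 / 3 : ℝ) • (pseudoRot x 0 1 + pseudoRot x 1 0 + pseudoRot x 3 1),
    (1 / 3 : ℝ) • (pseudoRot x 1 1 + pseudoRot x 2 0 + pseudoRot x 3 2),
    (1 / 3 : ℝ) • (pseudoRot x 0 2 + pseudoRot x 1 2 + pseudoRot x 2 2)]

/-- The transformation before normalization of the volume: the new tetrahedron is translated so
that its vertex `0` lies at the origin, and is written as the matrix of its other vertices. -/
noncomputable def preTheta (x : Matrix (Fin 3) (Fin 3) ℝ) : Matrix (Fin 3) (Fin 3) ℝ :=
  Matrix.of fun i k => (newVertex x k.succ - newVertex x 0) i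

/-- The normalizing factor `(det x / det Θ̃(x))^(1/3)`. -/
noncomputable def scale (x : Matrix (Fin 3) (Fin 3) ℝ) : ℝ :=
  (x.det / (preTheta x).det) ^ (1 / 3 : ℝ)

theorem ratio_nonneg (x : Matrix (Fin 3) (Fin 3) ℝ) (i : Fin 4) (j : Fin 3) :
    0 ≤ ratio x i j := by
  unfold ratio; positivity

/-- Up to the factor `9`, the matrix `N` with `Θ̃(x) = x * N`, in terms of the twelve ratios. -/
def coeffMatrix (r : Fin 4 → Fin 3 → ℝ) : Matrix (Fin 3) (Fin 3) ℝ :=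
  !![3 + 2 * (r 0 1 + r 1 0 + r 3 1) - (2 - r 0 0 - r 3 0),
      2 - r 1 1 - r 3 2 - (2 - r 0 0 - r 3 0),
      2 - r 0 2 - r 1 2 - (2 - r 0 0 - r 3 0);
    2 - r 1 0 - r 3 1 - (2 - r 2 1 - r 3 0),
      3 + 2 * (r 1 1 + r 2 0 + r 3 2) - (2 - r 2 1 - r 3 0),
      2 - r 1 2 - r 2 2 - (2 - r 2 1 - r 3 0);
    2 - r 0 1 - r 1 0 - (2 - r 0 0 - r 2 1),
      2 - r 1 1 - r 2 0 - (2 - r 0 0 - r 2 1),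
      3 + 2 * (r 0 2 + r 1 2 + r 2 2) - (2 - r 0 0 - r 2 1)]

theorem preTheta_eq (x : Matrix (Fin 3) (Fin 3) ℝ) :
    preTheta x = (1 / 9 : ℝ) • (x * coeffMatrix (ratio x)) := by
  have h (i : Fin 4) (j : Fin 3) (a : Fin 3) : pseudoRot x i j a =
      ratio x i j * (vertex x (face i j) a - centroid x i a) + centroid x i a := rfl
  have hc (i : Fin 4) (a : Fin 3) : centroid x i a = (1 / 3 : ℝ) *
      (vertex x (face i 0) a + vertex x (face i 1) a + vertex x (face i 2) a) := by
    simp [centroid, Fin.sum_univ_three]; ring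
  have v0 (a : Fin 3) : vertex x 0 a = 0 := rfl
  have v1 (a : Fin 3) : vertex x 1 a = x a 0 := rfl
  have v2 (a : Fin 3) : vertex x 2 a = x a 1 := rfl
  have v3 (a : Fin 3) : vertex x 3 a = x a 2 := rfl
  have n0 (a : Fin 3) : newVertex x 0 a =
      (1 / 3 : ℝ) * (pseudoRot x 0 0 a + pseudoRot x 2 1 a + pseudoRot x 3 0 a) := rfl
  have n1 (a : Fin 3) : newVertex x 1 a =
      (1 / 3 : ℝ) * (pseudoRot x 0 1 a + pseudoRot x 1 0 a + pseudoRot x 3 1 a) := rfl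
  have n2 (a : Fin 3) : newVertex x 2 a =
      (1 / 3 : ℝ) * (pseudoRot x 1 1 a + pseudoRot x 2 0 a + pseudoRot x 3 2 a) := rfl
  have n3 (a : Fin 3) : newVertex x 3 a =
      (1 / 3 : ℝ) * (pseudoRot x 0 2 a + pseudoRot x 1 2 a + pseudoRot x 2 2 a) := rfl
  have hp (a k : Fin 3) : preTheta x a k = newVertex x k.succ a - newVertex x 0 a := rfl
  have f0 : face 0 0 = 0 ∧ face 0 1 = 1 ∧ face 0 2 = 3 := ⟨rfl, rfl, rfl⟩
  have f1 : face 1 0 = 1 ∧ face 1 1 = 2 ∧ face 1 2 = 3 := ⟨rfl, rfl, rfl⟩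
  have f2 : face 2 0 = 2 ∧ face 2 1 = 0 ∧ face 2 2 = 3 := ⟨rfl, rfl, rfl⟩
  have f3 : face 3 0 = 0 ∧ face 3 1 = 1 ∧ face 3 2 = 2 := ⟨rfl, rfl, rfl⟩
  have e (a k : Fin 3) : (x * coeffMatrix (ratio x)) a k = x a 0 * coeffMatrix (ratio x) 0 k
      + x a 1 * coeffMatrix (ratio x) 1 k + x a 2 * coeffMatrix (ratio x) 2 k := by
    rw [Matrix.mul_apply, Fin.sum_univ_three]
  generalize ratio x = r at *
  ext a k
  rw [Matrix.smul_apply, e, hp, smul_eq_mul]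
  fin_cases k
  · change newVertex x 1 a - newVertex x 0 a = _
    simp only [n0, n1, h, hc, f0, f1, f2, f3, v0, v1, v2, v3]
    simp only [coeffMatrix, Matrix.of_apply, Matrix.cons_val', Matrix.cons_val_zero,
      Matrix.cons_val_one, Matrix.cons_val_fin_one, Matrix.cons_val, Fin.zero_eta]
    ring
  · change newVertex x 2 a - newVertex x 0 a = _
    simp only [n0, n2, h, hc, f0, f1, f2, f3, v0, v1, v2, v3]
    simp only [coeffMatrix, Matrix.of_apply, Matrix.cons_val', Matrix.cons_val_zero,
      Matrix.cons_val_one, Matrix.cons_val_fin_one, Matrix.cons_val, Fin.mk_one]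
    ring
  · change newVertex x 3 a - newVertex x 0 a = _
    simp only [n0, n3, h, hc, f0, f1, f2, f3, v0, v1, v2, v3]
    simp only [coeffMatrix, Matrix.of_apply, Matrix.cons_val', Matrix.cons_val_zero,
      Matrix.cons_val_one, Matrix.cons_val_fin_one, Matrix.cons_val, Fin.reduceFinMk]
    ring

set_option maxRecDepth 100000 in
theorem det_coeffMatrix_pos (r : Fin 4 → Fin 3 → ℝ) (hr : ∀ i j, 0 ≤ r i j) :
    0 < (coeffMatrix r).det := by
  rw [Matrix.det_fin_three]
  simp only [coeffMatrix, Matrix.of_apply, Matrix.cons_val', Matrix.cons_val_zero,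
    Matrix.cons_val_one, Matrix.cons_val_fin_one, Matrix.cons_val]
  have h00 := hr 0 0
  have h01 := hr 0 1
  have h02 := hr 0 2
  have h10 := hr 1 0
  have h11 := hr 1 1
  have h12 := hr 1 2
  have h20 := hr 2 0
  have h21 := hr 2 1
  have h22 := hr 2 2
  have h30 := hr 3 0
  have h31 := hr 3 1
  have h32 := hr 3 2
  generalize r 0 0 = a0 at *
  generalize r 0 1 = a1 at *
  generalize r 0 2 = a2 at *
  generalize r 1 0 = b0 at *
  generalize r 1 1 = b1 at *
  generalize r 1 2 = b2 at *
  generalize r 2 0 = c0 at *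
  generalize r 2 1 = c1 at *
  generalize r 2 2 = c2 at *
  generalize r 3 0 = d0 at *
  generalize r 3 1 = d1 at *
  generalize r 3 2 = d2 at *
  ring_nf
  positivity

theorem det_preTheta_pos (x : Matrix (Fin 3) (Fin 3) ℝ) (hx : 0 < x.det) :
    0 < (preTheta x).det := by
  rw [preTheta_eq, Matrix.det_smul, Matrix.det_mul]
  have := det_coeffMatrix_pos (ratio x) (ratio_nonneg x)
  positivity

theorem det_scale_smul (x : Matrix (Fin 3) (Fin 3) ℝ) (hx : 0 < x.det) :
    (scale x • preTheta x).det = x.det := by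
  have h := det_preTheta_pos x hx
  have h3 : scale x ^ 3 = x.det / (preTheta x).det := by
    unfold scale
    rw [← Real.rpow_natCast, ← Real.rpow_mul (by positivity)]
    norm_num
  rw [Matrix.det_smul, Fintype.card_fin, h3]
  field_simp

/-- The tetrahedron transformation `Θ(x) = (det x / det Θ̃(x))^(1/3) Θ̃(x)` on `SL(3, ℝ)`. -/
noncomputable def Theta (x : Tet) : Tet :=
  ⟨scale x.1 • preTheta x.1, by
    rw [det_scale_smul x.1 (by rw [x.2]; exact one_pos), x.2]⟩

/-- A tetrahedron is regular if its six edges have the same length. -/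
def IsRegularTet (x : Tet) : Prop :=
  ∀ i j k l : Fin 4, i ≠ j → k ≠ l →
    dist (vertex x.1 i) (vertex x.1 j) = dist (vertex x.1 k) (vertex x.1 l)

/-- The orbit of `x` under left multiplication by `SO(3, ℝ)`. -/
def orbitSO (x : Tet) : Set Tet :=
  {y | ∃ ρ ∈ Matrix.specialOrthogonalGroup (Fin 3) ℝ, y.1 = ρ * x.1}

/-- A local attractor of a continuous map `T`: a compact set `A` with `T(A) ⊆ A` that has an open
neighbourhood `U` with `T(U) ⊆ U` and `⋂ₙ Tⁿ(U) = A`. -/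
def IsLocalAttractor {X : Type*} [TopologicalSpace X] (T : X → X) (A : Set X) : Prop :=
  Continuous T ∧ IsCompact A ∧ T '' A ⊆ A ∧
    ∃ U : Set X, IsOpen U ∧ A ⊆ U ∧ T '' U ⊆ U ∧ ⋂ n : ℕ, T^[n] '' U = A

/-- An (embedded) smooth `d`-dimensional submanifold of a finite-dimensional space: locally the
zero set of a smooth map to `ℝᵐ`, where `d + m` is the dimension of the space, whose derivative
is surjective at the points of the set. -/
def IsSmoothSubmanifold {E : Type*} [NormedAddCommGroup E] [NormedSpace ℝ E]
    (d : ℕ) (S : Set E) : Prop :=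
  ∃ m : ℕ, d + m = Module.finrank ℝ E ∧
    ∀ p ∈ S, ∃ W : Set E, IsOpen W ∧ p ∈ W ∧ ∃ g : E → EuclideanSpace ℝ (Fin m),
      ContDiffOn ℝ ∞ g W ∧ (∀ q ∈ S ∩ W, Function.Surjective (fderiv ℝ g q)) ∧
      S ∩ W = {q ∈ W | g q = 0}

/-- The inclusion of `SL(3, ℝ)` into the space `ℝ⁹` of `3 × 3` arrays. (A subset of `SL(3, ℝ)` is
a submanifold of `SL(3, ℝ)` if and only if its image is a submanifold of `ℝ⁹`.) -/
def toArray (x : Tet) : Fin 3 → Fin 3 → ℝ := fun i j => x.1 i j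

end Tetra

/-! Every ratio in the construction is determined by squared edge lengths and is unchanged by
scaling. Hence `Theta x = x * N`, with `N` unimodular and depending only on the shape of `x`: its
six squared edge lengths, rescaled to mean 1 (`Theta_val`). The dynamics splits into a self-map of
shapes (`shapeMap`) and a right multiplication driven by it.

The shape map fixes the regular shape. On the hyperplane of vectors with coordinate sum zero, its
derivative there has Euclidean operator norm at most 9/10 (`norm_shapeDeriv_le`), so nearby shapes
contract to the regular one at a geometric rate. At the regular shape `N = 1`, so regular tetrahedra
are fixed points. By comparison of Gram matrices, they form exactly the orbit of `xeq`
(`mem_orbitSO_iff_shape`). This gives the attractor and the invariance of the orbit.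

Contraction of shapes alone does not exclude drift along the orbit. However, `N` is differentiable
at the regular shape, so the successive factors differ from 1 by a geometrically small amount, and
their infinite product converges (`exists_tendsto_of_mul_near_one`).

The orbit is a submanifold because, inside the open set `det > 0`, it is a fibre of the squared-edge
map from ℝ⁹ to ℝ⁶, which is a submersion there. -/

namespace Tetra

/-! ### Squared edge lengths and their change under right multiplication -/

/-- The space of the squared lengths of the six edges of a tetrahedron. -/
abbrev EdgeSpace : Type := EuclideanSpace ℝ (Fin 6)

/-- The six edges, given by the indices of their end points. -/
def edge : Fin 6 → Fin 4 × Fin 4 := ![(0, 1), (0, 2), (0, 3), (1, 2), (1, 3), (2, 3)]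

/-- The squared lengths of the six edges of a tetrahedron. -/
noncomputable def sqEdge (x : Matrix (Fin 3) (Fin 3) ℝ) : EdgeSpace :=
  WithLp.toLp 2 fun e => dist (vertex x (edge e).1) (vertex x (edge e).2) ^ 2

/-- The edge of the `i`-th face opposite to the `j`-th vertex of this face. -/
def oppEdge : Fin 4 → Fin 3 → Fin 6 := ![![4, 2, 0], ![5, 4, 3], ![2, 5, 1], ![3, 1, 0]]

/-- Nine times the squared distance from the `j`-th vertex of the `i`-th face to the centroid of
this face, in terms of the squared edge lengths. -/
def medianSq (q : EdgeSpace) (i : Fin 4) (j : Fin 3) : ℝ :=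
  2 * (q (oppEdge i 0) + q (oppEdge i 1) + q (oppEdge i 2)) - 3 * q (oppEdge i j)

/-- The ratios in the pseudo-rotations, in terms of the squared edge lengths. -/
noncomputable def edgeRatio (q : EdgeSpace) (i : Fin 4) (j : Fin 3) : ℝ :=
  √(medianSq q i (j - 1) / medianSq q i j)

/-- The squared length of a combination of the vectors from vertex `0` to the vertices `1, 2, 3`,
in terms of the squared edge lengths. -/
def edgeForm (u₀ u₁ u₂ : ℝ) (q : EdgeSpace) : ℝ :=
  u₀ ^ 2 * q 0 + u₁ ^ 2 * q 1 + u₂ ^ 2 * q 2 + u₀ * u₁ * (q 0 + q 1 - q 3)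
    + u₀ * u₂ * (q 0 + q 2 - q 4) + u₁ * u₂ * (q 1 + q 2 - q 5)

/-- The squared edge lengths of the tetrahedron `x * m` when those of `x` are `q`. -/
def mulSqEdge (q : EdgeSpace) (m : Matrix (Fin 3) (Fin 3) ℝ) : Fin 6 → ℝ :=
  ![edgeForm (m 0 0) (m 1 0) (m 2 0) q,
    edgeForm (m 0 1) (m 1 1) (m 2 1) q,
    edgeForm (m 0 2) (m 1 2) (m 2 2) q,
    edgeForm (m 0 0 - m 0 1) (m 1 0 - m 1 1) (m 2 0 - m 2 1) q,
    edgeForm (m 0 0 - m 0 2) (m 1 0 - m 1 2) (m 2 0 - m 2 2) q,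
    edgeForm (m 0 1 - m 0 2) (m 1 1 - m 1 2) (m 2 1 - m 2 2) q]

theorem sqEdge_apply (x : Matrix (Fin 3) (Fin 3) ℝ) (e : Fin 6) :
    sqEdge x e = dist (vertex x (edge e).1) (vertex x (edge e).2) ^ 2 := rfl

theorem dist_sq_eq (a b : Pt) :
    dist a b ^ 2 = (a 0 - b 0) ^ 2 + (a 1 - b 1) ^ 2 + (a 2 - b 2) ^ 2 := by
  rw [dist_eq_norm, EuclideanSpace.norm_sq_eq]
  simp [Fin.sum_univ_three]

theorem sqEdge_eq (x : Matrix (Fin 3) (Fin 3) ℝ) : (sqEdge x : Fin 6 → ℝ) =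
    ![x 0 0 ^ 2 + x 1 0 ^ 2 + x 2 0 ^ 2,
      x 0 1 ^ 2 + x 1 1 ^ 2 + x 2 1 ^ 2,
      x 0 2 ^ 2 + x 1 2 ^ 2 + x 2 2 ^ 2,
      (x 0 0 - x 0 1) ^ 2 + (x 1 0 - x 1 1) ^ 2 + (x 2 0 - x 2 1) ^ 2,
      (x 0 0 - x 0 2) ^ 2 + (x 1 0 - x 1 2) ^ 2 + (x 2 0 - x 2 2) ^ 2,
      (x 0 1 - x 0 2) ^ 2 + (x 1 1 - x 1 2) ^ 2 + (x 2 1 - x 2 2) ^ 2] := by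
  ext e
  rw [sqEdge_apply, dist_sq_eq]
  fin_cases e <;> simp [edge, vertex, column]

/-- Edges of `x * m` are combinations of the columns of `x`, with coefficients read off from `m`;
polarization writes the inner products of those columns through squared edges. -/
theorem sqEdge_mul (x m : Matrix (Fin 3) (Fin 3) ℝ) :
    (sqEdge (x * m) : Fin 6 → ℝ) = mulSqEdge (sqEdge x) m := by
  rw [sqEdge_eq]
  ext e
  fin_cases e <;>
    simp [mulSqEdge, edgeForm, sqEdge_eq, Matrix.mul_apply, Fin.sum_univ_three] <;> ring

/-- Apollonius' median formula; the centroid lies two thirds of the way along the median, whence the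
factor 9. -/
theorem norm_sub_third_sq (a b c : Pt) :
    9 * ‖a - (1 / 3 : ℝ) • (a + b + c)‖ ^ 2 =
      2 * (dist b c ^ 2 + dist c a ^ 2 + dist a b ^ 2) - 3 * dist b c ^ 2 := by
  rw [← dist_eq_norm, dist_sq_eq, dist_sq_eq, dist_sq_eq, dist_sq_eq]
  simp
  ring

theorem sqEdge_oppEdge (x : Matrix (Fin 3) (Fin 3) ℝ) (i : Fin 4) (j : Fin 3) :
    sqEdge x (oppEdge i j) =
      dist (vertex x (face i (j + 1))) (vertex x (face i (j + 2))) ^ 2 := by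
  rw [sqEdge_apply]
  fin_cases i <;> fin_cases j <;> first | rfl | (rw [dist_comm]; rfl)

theorem medianSq_sqEdge (x : Matrix (Fin 3) (Fin 3) ℝ) (i : Fin 4) (j : Fin 3) :
    medianSq (sqEdge x) i j = 9 * ‖vertex x (face i j) - centroid x i‖ ^ 2 := by
  simp only [medianSq, sqEdge_oppEdge, centroid, Fin.sum_univ_three]
  generalize vertex x = v
  generalize face i = f
  fin_cases j
  · exact (norm_sub_third_sq _ _ _).symm
  · have := norm_sub_third_sq (v (f 1)) (v (f 2)) (v (f 0))
    rw [show v (f 0) + v (f 1) + v (f 2) = v (f 1) + v (f 2) + v (f 0) by abel]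
    refine Eq.trans ?_ this.symm
    simp only [Fin.reduceAdd, Fin.mk_one, Fin.isValue, zero_add]
    ring
  · have := norm_sub_third_sq (v (f 2)) (v (f 0)) (v (f 1))
    rw [show v (f 0) + v (f 1) + v (f 2) = v (f 2) + v (f 0) + v (f 1) by abel]
    refine Eq.trans ?_ this.symm
    simp only [Fin.reduceAdd, Fin.reduceFinMk, Fin.isValue, zero_add]
    ring

theorem ratio_eq_edgeRatio (x : Matrix (Fin 3) (Fin 3) ℝ) : ratio x = edgeRatio (sqEdge x) := by
  ext i j
  rw [edgeRatio, medianSq_sqEdge, medianSq_sqEdge, mul_div_mul_left _ _ (by norm_num), ← div_pow,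
    Real.sqrt_sq (by positivity), ratio, div_eq_mul_inv]

theorem medianSq_smul (c : ℝ) (q : EdgeSpace) (i : Fin 4) (j : Fin 3) :
    medianSq (c • q) i j = c * medianSq q i j := by
  simp [medianSq]; ring

theorem edgeRatio_smul {c : ℝ} (hc : c ≠ 0) (q : EdgeSpace) : edgeRatio (c • q) = edgeRatio q := by
  ext i j
  rw [edgeRatio, medianSq_smul, medianSq_smul, mul_div_mul_left _ _ hc, edgeRatio]

theorem mulSqEdge_smul (c : ℝ) (q : EdgeSpace) (m : Matrix (Fin 3) (Fin 3) ℝ) :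
    mulSqEdge (c • q) m = c • mulSqEdge q m := by
  ext e
  fin_cases e <;> simp [mulSqEdge, edgeForm] <;> ring

theorem sqEdge_smul (c : ℝ) (x : Matrix (Fin 3) (Fin 3) ℝ) : sqEdge (c • x) = c ^ 2 • sqEdge x := by
  ext e
  rw [PiLp.smul_apply, sqEdge_eq, sqEdge_eq]
  fin_cases e <;> simp <;> ring

/-! ### Normalization and the induced map on shapes -/

/-- The sum of the coordinates. -/
def total (q : EdgeSpace) : ℝ := q 0 + q 1 + q 2 + q 3 + q 4 + q 5

theorem total_smul (c : ℝ) (q : EdgeSpace) : total (c • q) = c * total q := by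
  simp [total]; ring

/-- The normalization of the squared edge lengths to mean `1`. -/
noncomputable def normalize (q : EdgeSpace) : EdgeSpace := (6 / total q) • q

theorem normalize_smul {c : ℝ} (hc : c ≠ 0) (q : EdgeSpace) : normalize (c • q) = normalize q := by
  rw [normalize, total_smul, smul_smul, normalize]
  congr 1
  field_simp

theorem total_normalize {q : EdgeSpace} (hq : total q ≠ 0) : total (normalize q) = 6 := by
  rw [normalize, total_smul]; field_simp

/-- The squared edge lengths of `9 • preTheta x`, in terms of those of `x`. -/
noncomputable def newSqEdge (q : EdgeSpace) : EdgeSpace :=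
  WithLp.toLp 2 (mulSqEdge q (coeffMatrix (edgeRatio q)))

theorem newSqEdge_smul {c : ℝ} (hc : c ≠ 0) (q : EdgeSpace) :
    newSqEdge (c • q) = c • newSqEdge q := by
  rw [newSqEdge, edgeRatio_smul hc, mulSqEdge_smul]; rfl

theorem sqEdge_preTheta (x : Matrix (Fin 3) (Fin 3) ℝ) :
    sqEdge (preTheta x) = (1 / 9 : ℝ) ^ 2 • newSqEdge (sqEdge x) := by
  rw [preTheta_eq, sqEdge_smul, ratio_eq_edgeRatio]
  congr 1
  ext e
  rw [sqEdge_mul]; rfl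

/-- The normalized squared edge lengths. -/
noncomputable def shape (x : Tet) : EdgeSpace := normalize (sqEdge x.1)

theorem det_eq_zero_of_mulVec {x : Matrix (Fin 3) (Fin 3) ℝ} {w : Fin 3 → ℝ} (hw : w ≠ 0)
    (h : x.mulVec w = 0) : x.det = 0 :=
  Matrix.exists_mulVec_eq_zero_iff.1 ⟨w, hw, h⟩

/-- Three times this difference is `x` applied to a nonzero integer vector, and `x` is invertible.
Thus no ratio has a vanishing denominator on `SL(3, ℝ)`. -/
theorem vertex_ne_centroid (x : Tet) (i : Fin 4) (j : Fin 3) :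
    vertex x.1 (face i j) - centroid x.1 i ≠ 0 := by
  intro h0
  have h (a : Fin 3) := congrArg (fun v : Pt => v a) h0
  let u : Fin 4 → Fin 3 → ℤ := ![0, ![1, 0, 0], ![0, 1, 0], ![0, 0, 1]]
  have hu : ∀ i j, ∃ b, 3 * u (face i j) b -
      (u (face i 0) b + u (face i 1) b + u (face i 2) b) ≠ 0 := by decide
  have hv (k : Fin 4) (a : Fin 3) : vertex x.1 k a = ∑ b, x.1 a b * u k b := by
    fin_cases k <;> simp [vertex, column, u, Fin.sum_univ_three]
  have hdet := x.2
  rw [det_eq_zero_of_mulVec (w := fun b => ((3 * u (face i j) b -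
    (u (face i 0) b + u (face i 1) b + u (face i 2) b) : ℤ) : ℝ))] at hdet
  · exact zero_ne_one hdet
  · intro hw
    obtain ⟨b, hb⟩ := hu i j
    exact hb ((Int.cast_eq_zero (α := ℝ)).1 (congrFun hw b))
  · ext a
    have := h a
    simp only [centroid, Fin.sum_univ_three, PiLp.sub_apply, PiLp.smul_apply, PiLp.add_apply, hv,
      smul_eq_mul, PiLp.zero_apply] at this
    simp only [Matrix.mulVec, dotProduct, Fin.sum_univ_three, Pi.zero_apply]
    push_cast
    linarith

theorem medianSq_pos (x : Tet) (i : Fin 4) (j : Fin 3) : 0 < medianSq (sqEdge x.1) i j := by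
  rw [medianSq_sqEdge]
  have := norm_pos_iff.2 (vertex_ne_centroid x i j)
  positivity

theorem total_sqEdge_pos (x : Tet) : 0 < total (sqEdge x.1) := by
  have h0 := medianSq_pos x 0 0
  have h (e : Fin 6) : 0 ≤ sqEdge x.1 e := by rw [sqEdge_apply]; positivity
  have : medianSq (sqEdge x.1) 0 0 ≤ 2 * total (sqEdge x.1) := by
    change 2 * (sqEdge x.1 4 + sqEdge x.1 2 + sqEdge x.1 0) - 3 * sqEdge x.1 4 ≤ _
    unfold total
    linarith [h 0, h 1, h 2, h 3, h 4, h 5]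
  linarith

theorem edgeRatio_shape (x : Tet) : edgeRatio (shape x) = ratio x.1 := by
  rw [shape, normalize, edgeRatio_smul, ratio_eq_edgeRatio]
  exact (div_pos (by norm_num) (total_sqEdge_pos x)).ne'

theorem total_shape (x : Tet) : total (shape x) = 6 := total_normalize (total_sqEdge_pos x).ne'

theorem scale_pos (x : Tet) : 0 < scale x.1 := by
  have h : 0 < x.1.det := by rw [x.2]; exact one_pos
  have := det_preTheta_pos x.1 h
  unfold scale; positivity

/-- The volume factor and the factor 1/9 are lost under normalization, and `newSqEdge` is
homogeneous of degree one, so normalizing its argument changes nothing either. -/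
theorem shape_Theta (x : Tet) : shape (Theta x) = normalize (newSqEdge (shape x)) := by
  have h1 : (Theta x).1 = scale x.1 • preTheta x.1 := rfl
  rw [shape, h1, sqEdge_smul, normalize_smul (pow_pos (scale_pos x) 2).ne', sqEdge_preTheta,
    normalize_smul (by norm_num), shape, normalize, normalize, normalize, ← normalize, ← normalize,
    normalize, newSqEdge_smul, ← normalize, normalize_smul]
  all_goals exact (div_pos (by norm_num) (total_sqEdge_pos x)).ne'

/-- The unimodular matrix by which `Theta` multiplies a tetrahedron with the given shape. -/
noncomputable def stepMatrix (q : EdgeSpace) : Matrix (Fin 3) (Fin 3) ℝ :=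
  (1 / ((1 / 9) ^ 3 * (coeffMatrix (edgeRatio q)).det)) ^ (1 / 3 : ℝ) •
    (1 / 9 : ℝ) • coeffMatrix (edgeRatio q)

/-- Since `det x = 1`, the volume factor also depends on the ratios alone, hence on the shape alone.
-/
theorem Theta_val (x : Tet) : (Theta x).1 = x.1 * stepMatrix (shape x) := by
  change scale x.1 • preTheta x.1 = _
  rw [stepMatrix, edgeRatio_shape, scale, preTheta_eq, Matrix.det_smul, Matrix.det_mul, x.2,
    one_mul, Fintype.card_fin, Matrix.mul_smul, Matrix.mul_smul]

/-! ### Linearization at the regular shape -/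

/-- The normalized squared edge lengths of a regular tetrahedron. -/
def unitShape : EdgeSpace := WithLp.toLp 2 fun _ => 1

@[simp] theorem unitShape_apply (e : Fin 6) : unitShape e = 1 := rfl

theorem medianSq_line (v : EdgeSpace) (t : ℝ) (i : Fin 4) (j : Fin 3) :
    medianSq (unitShape + t • v) i j = 3 + t * medianSq v i j := by
  simp [medianSq]; ring

/-- Both median terms equal 3 at the base point, so the derivative is one sixth of the difference of
their variations; the part common to the face cancels. -/
theorem hasDerivAt_edgeRatio (v : EdgeSpace) (i : Fin 4) (j : Fin 3) :
    HasDerivAt (fun t : ℝ => edgeRatio (unitShape + t • v) i j)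
      ((v (oppEdge i j) - v (oppEdge i (j - 1))) / 2) 0 := by
  simp only [edgeRatio, medianSq_line]
  have h (j : Fin 3) : HasDerivAt (fun t : ℝ => 3 + t * medianSq v i j) (medianSq v i j) 0 := by
    simpa using ((hasDerivAt_id (0 : ℝ)).mul_const (medianSq v i j)).const_add 3
  refine (((h (j - 1)).div (h j) (by norm_num)).sqrt (by norm_num)).congr_deriv ?_
  norm_num [Pi.div_apply]
  simp only [medianSq]
  ring

theorem edgeRatio_unitShape (i : Fin 4) (j : Fin 3) : edgeRatio unitShape i j = 1 := by
  norm_num [edgeRatio, medianSq]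

theorem hasDerivAt_coeff_diag {a b c d e : ℝ → ℝ} {a' b' c' d' e' : ℝ}
    (ha : HasDerivAt a a' 0) (hb : HasDerivAt b b' 0) (hc : HasDerivAt c c' 0)
    (hd : HasDerivAt d d' 0) (he : HasDerivAt e e' 0) :
    HasDerivAt (fun t => 3 + 2 * (a t + b t + c t) - (2 - d t - e t))
      (2 * (a' + b' + c') + d' + e') 0 :=
  (((((ha.add hb).add hc).const_mul 2).const_add 3).sub ((hd.const_sub 2).sub he)).congr_deriv
    (by ring)

theorem hasDerivAt_coeff_offDiag {a b d e : ℝ → ℝ} {a' b' d' e' : ℝ}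
    (ha : HasDerivAt a a' 0) (hb : HasDerivAt b b' 0)
    (hd : HasDerivAt d d' 0) (he : HasDerivAt e e' 0) :
    HasDerivAt (fun t => 2 - a t - b t - (2 - d t - e t)) (d' + e' - a' - b') 0 :=
  (((ha.const_sub 2).sub hb).sub ((hd.const_sub 2).sub he)).congr_deriv (by ring)

/-- The linear part of `coeffMatrix`. -/
def coeffMatrixDeriv (r : Fin 4 → Fin 3 → ℝ) : Matrix (Fin 3) (Fin 3) ℝ :=
  !![2 * (r 0 1 + r 1 0 + r 3 1) + r 0 0 + r 3 0, r 0 0 + r 3 0 - r 1 1 - r 3 2,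
      r 0 0 + r 3 0 - r 0 2 - r 1 2;
    r 2 1 + r 3 0 - r 1 0 - r 3 1, 2 * (r 1 1 + r 2 0 + r 3 2) + r 2 1 + r 3 0,
      r 2 1 + r 3 0 - r 1 2 - r 2 2;
    r 0 0 + r 2 1 - r 0 1 - r 1 0, r 0 0 + r 2 1 - r 1 1 - r 2 0,
      2 * (r 0 2 + r 1 2 + r 2 2) + r 0 0 + r 2 1]

theorem hasDerivAt_coeffMatrix {r : ℝ → Fin 4 → Fin 3 → ℝ} {r' : Fin 4 → Fin 3 → ℝ}
    (h : ∀ i j, HasDerivAt (fun t => r t i j) (r' i j) 0) (a b : Fin 3) :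
    HasDerivAt (fun t => coeffMatrix (r t) a b) (coeffMatrixDeriv r' a b) 0 := by
  fin_cases a <;> fin_cases b
  · exact hasDerivAt_coeff_diag (h 0 1) (h 1 0) (h 3 1) (h 0 0) (h 3 0)
  · exact hasDerivAt_coeff_offDiag (h 1 1) (h 3 2) (h 0 0) (h 3 0)
  · exact hasDerivAt_coeff_offDiag (h 0 2) (h 1 2) (h 0 0) (h 3 0)
  · exact hasDerivAt_coeff_offDiag (h 1 0) (h 3 1) (h 2 1) (h 3 0)
  · exact hasDerivAt_coeff_diag (h 1 1) (h 2 0) (h 3 2) (h 2 1) (h 3 0)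
  · exact hasDerivAt_coeff_offDiag (h 1 2) (h 2 2) (h 2 1) (h 3 0)
  · exact hasDerivAt_coeff_offDiag (h 0 1) (h 1 0) (h 0 0) (h 2 1)
  · exact hasDerivAt_coeff_offDiag (h 1 1) (h 2 0) (h 0 0) (h 2 1)
  · exact hasDerivAt_coeff_diag (h 0 2) (h 1 2) (h 2 2) (h 0 0) (h 2 1)

theorem coeffMatrix_one : coeffMatrix (fun _ _ => 1) = 9 • (1 : Matrix (Fin 3) (Fin 3) ℝ) := by
  ext i j
  fin_cases i <;> fin_cases j <;> norm_num [coeffMatrix]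

theorem coeffMatrix_unitShape :
    coeffMatrix (edgeRatio unitShape) = 9 • (1 : Matrix (Fin 3) (Fin 3) ℝ) := by
  rw [← coeffMatrix_one]
  congr 1
  ext i j
  exact edgeRatio_unitShape i j

theorem hasDerivAt_edgeForm {u₀ u₁ u₂ : ℝ → ℝ} {u₀' u₁' u₂' : ℝ} (v : EdgeSpace)
    (h₀ : HasDerivAt u₀ u₀' 0) (h₁ : HasDerivAt u₁ u₁' 0) (h₂ : HasDerivAt u₂ u₂' 0) :
    HasDerivAt (fun t : ℝ => edgeForm (u₀ t) (u₁ t) (u₂ t) (unitShape + t • v))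
      (edgeForm (u₀ 0) (u₁ 0) (u₂ 0) v + (2 * u₀ 0 + u₁ 0 + u₂ 0) * u₀'
        + (2 * u₁ 0 + u₀ 0 + u₂ 0) * u₁' + (2 * u₂ 0 + u₀ 0 + u₁ 0) * u₂') 0 := by
  have hq (e : Fin 6) : HasDerivAt (fun t : ℝ => (unitShape + t • v) e) (v e) 0 := by
    simpa using ((hasDerivAt_id (0 : ℝ)).mul_const (v e)).const_add 1
  refine HasDerivAt.congr_deriv (((((((h₀.pow 2).mul (hq 0)).add ((h₁.pow 2).mul (hq 1))).add
    ((h₂.pow 2).mul (hq 2))).add ((h₀.mul h₁).mul (((hq 0).add (hq 1)).sub (hq 3)))).add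
    ((h₀.mul h₂).mul (((hq 0).add (hq 2)).sub (hq 4)))).add
    ((h₁.mul h₂).mul (((hq 1).add (hq 2)).sub (hq 5)))) ?_
  simp [edgeForm]
  ring

/-- The linearization of the action of `Theta` on the normalized squared edge lengths. -/
noncomputable def shapeDeriv (v : EdgeSpace) : EdgeSpace := WithLp.toLp 2
  ![(12 * v 0 + 3 * v 1 + v 2 - 2 * v 3 + 4 * v 5) / 18,
    (-2 * v 0 + 12 * v 1 + 3 * v 3 + 4 * v 4 + v 5) / 18,
    (-2 * v 0 + 3 * v 1 + 12 * v 2 + 4 * v 3 + v 4) / 18,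
    (3 * v 0 - 2 * v 1 + 4 * v 2 + 12 * v 3 + v 4) / 18,
    (3 * v 0 + 4 * v 1 - 2 * v 3 + 12 * v 4 + v 5) / 18,
    (4 * v 0 - 2 * v 1 + v 2 + 3 * v 3 + 12 * v 5) / 18]

/-- The factor 81 is `9 ^ 2`: the coefficient matrix is 9 times the identity at the base point, and
squared lengths scale quadratically. -/
theorem hasDerivAt_newSqEdge (v : EdgeSpace) (e : Fin 6) :
    HasDerivAt (fun t : ℝ => newSqEdge (unitShape + t • v) e) (81 * shapeDeriv v e) 0 := by
  have hC := hasDerivAt_coeffMatrix (hasDerivAt_edgeRatio v)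
  have h0 (a b : Fin 3) : coeffMatrix (edgeRatio (unitShape + (0 : ℝ) • v)) a b =
      9 * (1 : Matrix (Fin 3) (Fin 3) ℝ) a b := by
    rw [zero_smul, add_zero, coeffMatrix_unitShape]; simp
  have o : oppEdge 0 0 = 4 ∧ oppEdge 0 1 = 2 ∧ oppEdge 0 2 = 0 ∧ oppEdge 1 0 = 5 ∧ oppEdge 1 1 = 4 ∧
    oppEdge 1 2 = 3 ∧ oppEdge 2 0 = 2 ∧ oppEdge 2 1 = 5 ∧ oppEdge 2 2 = 1 ∧ oppEdge 3 0 = 3 ∧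
    oppEdge 3 1 = 1 ∧ oppEdge 3 2 = 0 := by decide
  have s : (0 : Fin 3) - 1 = 2 ∧ (1 : Fin 3) - 1 = 0 ∧ (2 : Fin 3) - 1 = 1 := by decide
  fin_cases e
  · refine (hasDerivAt_edgeForm v (hC 0 0) (hC 1 0) (hC 2 0)).congr_deriv ?_
    simp only [h0]
    simp [edgeForm, coeffMatrixDeriv, shapeDeriv, o, s]
    ring
  · refine (hasDerivAt_edgeForm v (hC 0 1) (hC 1 1) (hC 2 1)).congr_deriv ?_
    simp only [h0]
    simp [edgeForm, coeffMatrixDeriv, shapeDeriv, o, s]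
    ring
  · refine (hasDerivAt_edgeForm v (hC 0 2) (hC 1 2) (hC 2 2)).congr_deriv ?_
    simp only [h0]
    simp [edgeForm, coeffMatrixDeriv, shapeDeriv, o, s]
    ring
  · refine (hasDerivAt_edgeForm v ((hC 0 0).sub (hC 0 1)) ((hC 1 0).sub (hC 1 1))
      ((hC 2 0).sub (hC 2 1))).congr_deriv ?_
    simp only [Pi.sub_apply, h0]
    simp [edgeForm, coeffMatrixDeriv, shapeDeriv, o, s]
    ring
  · refine (hasDerivAt_edgeForm v ((hC 0 0).sub (hC 0 2)) ((hC 1 0).sub (hC 1 2))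
      ((hC 2 0).sub (hC 2 2))).congr_deriv ?_
    simp only [Pi.sub_apply, h0]
    simp [edgeForm, coeffMatrixDeriv, shapeDeriv, o, s]
    ring
  · refine (hasDerivAt_edgeForm v ((hC 0 1).sub (hC 0 2)) ((hC 1 1).sub (hC 1 2))
      ((hC 2 1).sub (hC 2 2))).congr_deriv ?_
    simp only [Pi.sub_apply, h0]
    simp [edgeForm, coeffMatrixDeriv, shapeDeriv, o, s]
    ring

theorem newSqEdge_unitShape : newSqEdge unitShape = (81 : ℝ) • unitShape := by
  ext e
  change mulSqEdge _ _ e = _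
  rw [coeffMatrix_unitShape]
  fin_cases e <;> simp [mulSqEdge, edgeForm] <;> norm_num

theorem total_unitShape : total unitShape = 6 := by
  norm_num [total]

theorem normalize_unitShape : normalize unitShape = unitShape := by
  rw [normalize, total_unitShape, div_self (by norm_num), one_smul]

/-- The action of `Theta` on the normalized squared edge lengths. -/
noncomputable def shapeMap (q : EdgeSpace) : EdgeSpace := normalize (newSqEdge q)

theorem shapeMap_unitShape : shapeMap unitShape = unitShape := by
  rw [shapeMap, newSqEdge_unitShape, normalize_smul (by norm_num), normalize_unitShape]

/-- Makes the normalizing factor stationary to first order along sum-zero directions. -/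
theorem total_shapeDeriv (v : EdgeSpace) : total (shapeDeriv v) = total v := by
  simp [total, shapeDeriv]; ring

theorem hasDerivAt_shapeMap {v : EdgeSpace} (hv : total v = 0) (e : Fin 6) :
    HasDerivAt (fun t : ℝ => shapeMap (unitShape + t • v) e) (shapeDeriv v e) 0 := by
  have h := hasDerivAt_newSqEdge v
  have hs : HasDerivAt (fun t : ℝ => total (newSqEdge (unitShape + t • v))) 0 0 := by
    refine ((((((h 0).add (h 1)).add (h 2)).add (h 3)).add (h 4)).add (h 5)).congr_deriv ?_
    have := total_shapeDeriv v
    rw [hv, total] at this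
    linarith
  have h0 : newSqEdge (unitShape + (0 : ℝ) • v) = (81 : ℝ) • unitShape := by
    rw [zero_smul, add_zero, newSqEdge_unitShape]
  refine (((hasDerivAt_const (0 : ℝ) (6 : ℝ)).div hs ?_).mul (h e)).congr_deriv ?_
  · rw [h0, total_smul, total_unitShape]; norm_num
  · simp only [Pi.div_apply]
    rw [h0, total_smul, total_unitShape]
    norm_num
    ring

/-- The sum-zero condition is essential: `unitShape`, the scaling direction, is an eigenvector of
eigenvalue 1. Eliminating `v 5` leaves a positive definite quadratic form in five variables. -/
theorem norm_shapeDeriv_le {v : EdgeSpace} (hv : total v = 0) :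
    ‖shapeDeriv v‖ ≤ 9 / 10 * ‖v‖ := by
  refine le_of_sq_le_sq ?_ (by positivity)
  rw [mul_pow, EuclideanSpace.norm_sq_eq, EuclideanSpace.norm_sq_eq]
  have h5 : v 5 = -(v 0 + v 1 + v 2 + v 3 + v 4) := by rw [total] at hv; linarith
  simp only [shapeDeriv, Fin.sum_univ_six, Real.norm_eq_abs, sq_abs, Matrix.cons_val, h5]
  generalize v 0 = a
  generalize v 1 = b
  generalize v 2 = c
  generalize v 3 = d
  generalize v 4 = e
  rw [← sub_nonneg]
  -- Successive completion of squares for `81/100 * ‖v‖² - ‖shapeDeriv v‖²`; 324 is the square of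
  -- the denominator 18.
  have key : (0 : ℝ) ≤ 1 / 324 * (9272 / 25 *
        (a + 617 / 1159 * b + 1309 / 2318 * c + 5561 / 9272 * d + 4611 / 9272 * e) ^ 2
      + 2311386 / 28975 *
        (b - 290569 / 1155693 * c + 319387 / 2311386 * d - 2165813 / 2311386 * e) ^ 2
      + 3165565714 / 28892325 *
        (c - 4299345343 / 6331131428 * d - 376099693 / 6331131428 * e) ^ 2
      + 391106572458 / 7913914285 * (d + 7695199 / 10354295 * e) ^ 2
      + 11243332584 / 258857375 * e ^ 2) := by positivity
  refine key.trans_eq ?_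
  ring

/-! ### Differentiability at the regular shape, contraction and the step matrix -/

theorem differentiableAt_edgeRatio (i : Fin 4) (j : Fin 3) :
    DifferentiableAt ℝ (fun q => edgeRatio q i j) unitShape := by
  have h (j : Fin 3) : DifferentiableAt ℝ (fun q => medianSq q i j) unitShape := by
    unfold medianSq; fun_prop
  have h1 (j : Fin 3) : medianSq unitShape i j = 3 := by norm_num [medianSq]
  simp only [edgeRatio, div_eq_mul_inv]
  refine ((h (j - 1)).fun_mul ((h j).fun_inv ?_)).sqrt ?_ <;> norm_num [h1]

theorem differentiableAt_coeff_diag {a b c d e : EdgeSpace → ℝ} {p : EdgeSpace}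
    (ha : DifferentiableAt ℝ a p) (hb : DifferentiableAt ℝ b p) (hc : DifferentiableAt ℝ c p)
    (hd : DifferentiableAt ℝ d p) (he : DifferentiableAt ℝ e p) :
    DifferentiableAt ℝ (fun q => 3 + 2 * (a q + b q + c q) - (2 - d q - e q)) p := by
  fun_prop

theorem differentiableAt_coeff_offDiag {a b d e : EdgeSpace → ℝ} {p : EdgeSpace}
    (ha : DifferentiableAt ℝ a p) (hb : DifferentiableAt ℝ b p)
    (hd : DifferentiableAt ℝ d p) (he : DifferentiableAt ℝ e p) :
    DifferentiableAt ℝ (fun q => 2 - a q - b q - (2 - d q - e q)) p := by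
  fun_prop

theorem differentiableAt_coeffMatrix (a b : Fin 3) :
    DifferentiableAt ℝ (fun q => coeffMatrix (edgeRatio q) a b) unitShape := by
  have h := differentiableAt_edgeRatio
  fin_cases a <;> fin_cases b
  · exact differentiableAt_coeff_diag (h 0 1) (h 1 0) (h 3 1) (h 0 0) (h 3 0)
  · exact differentiableAt_coeff_offDiag (h 1 1) (h 3 2) (h 0 0) (h 3 0)
  · exact differentiableAt_coeff_offDiag (h 0 2) (h 1 2) (h 0 0) (h 3 0)
  · exact differentiableAt_coeff_offDiag (h 1 0) (h 3 1) (h 2 1) (h 3 0)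
  · exact differentiableAt_coeff_diag (h 1 1) (h 2 0) (h 3 2) (h 2 1) (h 3 0)
  · exact differentiableAt_coeff_offDiag (h 1 2) (h 2 2) (h 2 1) (h 3 0)
  · exact differentiableAt_coeff_offDiag (h 0 1) (h 1 0) (h 0 0) (h 2 1)
  · exact differentiableAt_coeff_offDiag (h 1 1) (h 2 0) (h 0 0) (h 2 1)
  · exact differentiableAt_coeff_diag (h 0 2) (h 1 2) (h 2 2) (h 0 0) (h 2 1)

theorem differentiableAt_edgeForm {u₀ u₁ u₂ : EdgeSpace → ℝ} {p : EdgeSpace}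
    (h₀ : DifferentiableAt ℝ u₀ p) (h₁ : DifferentiableAt ℝ u₁ p) (h₂ : DifferentiableAt ℝ u₂ p) :
    DifferentiableAt ℝ (fun q => edgeForm (u₀ q) (u₁ q) (u₂ q) q) p := by
  unfold edgeForm; fun_prop

theorem differentiableAt_newSqEdge (e : Fin 6) :
    DifferentiableAt ℝ (fun q => newSqEdge q e) unitShape := by
  have h := differentiableAt_coeffMatrix
  have hs (a b c : Fin 3) := (h a b).fun_sub (h a c)
  fin_cases e
  · exact differentiableAt_edgeForm (h 0 0) (h 1 0) (h 2 0)
  · exact differentiableAt_edgeForm (h 0 1) (h 1 1) (h 2 1)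
  · exact differentiableAt_edgeForm (h 0 2) (h 1 2) (h 2 2)
  · exact differentiableAt_edgeForm (hs 0 0 1) (hs 1 0 1) (hs 2 0 1)
  · exact differentiableAt_edgeForm (hs 0 0 2) (hs 1 0 2) (hs 2 0 2)
  · exact differentiableAt_edgeForm (hs 0 1 2) (hs 1 1 2) (hs 2 1 2)

theorem differentiableAt_shapeMap : DifferentiableAt ℝ shapeMap unitShape := by
  have h := differentiableAt_newSqEdge
  rw [differentiableAt_euclidean]
  intro e
  simp only [shapeMap, normalize, PiLp.smul_apply, smul_eq_mul]
  have ht : DifferentiableAt ℝ (fun q => total (newSqEdge q)) unitShape := by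
    exact (((((h 0).add (h 1)).add (h 2)).add (h 3)).add (h 4)).add (h 5)
  simp only [div_eq_mul_inv]
  refine DifferentiableAt.fun_mul (DifferentiableAt.fun_mul (by fun_prop) (ht.fun_inv ?_)) (h e)
  rw [newSqEdge_unitShape, total_smul, total_unitShape]
  norm_num

/-- Differentiability is known abstractly, so the value on `v` can be read off from the derivative
along a line. -/
theorem fderiv_shapeMap {v : EdgeSpace} (hv : total v = 0) :
    fderiv ℝ shapeMap unitShape v = shapeDeriv v := by
  have hl : HasDerivAt (fun t : ℝ => unitShape + t • v) v 0 := by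
    simpa using ((hasDerivAt_id (0 : ℝ)).smul_const v).const_add unitShape
  have hd : HasFDerivAt shapeMap (fderiv ℝ shapeMap unitShape) (unitShape + (0 : ℝ) • v) := by
    simpa using differentiableAt_shapeMap.hasFDerivAt
  have h := hd.comp_hasDerivAt 0 hl
  ext e
  have he := (EuclideanSpace.proj (𝕜 := ℝ) e).hasFDerivAt.comp_hasDerivAt 0 h
  exact he.unique (hasDerivAt_shapeMap hv e)

theorem total_sub (p q : EdgeSpace) : total (p - q) = total p - total q := by
  simp [total]; ring

/-- Near the regular shape, `shapeMap` is a contraction towards it. -/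
theorem eventually_shapeMap_contracts : ∀ᶠ q in nhds unitShape, total q = 6 →
    ‖shapeMap q - unitShape‖ ≤ 19 / 20 * ‖q - unitShape‖ := by
  -- The error 1/20 added to the linear bound 9/10 gives 19/20.
  have h := differentiableAt_shapeMap.hasFDerivAt.isLittleO.def
    (show (0 : ℝ) < 1 / 20 by norm_num)
  filter_upwards [h] with q hq hq6
  have ht : total (q - unitShape) = 0 := by rw [total_sub, hq6, total_unitShape, sub_self]
  rw [fderiv_shapeMap ht, shapeMap_unitShape] at hq
  have h1 := norm_shapeDeriv_le ht
  have h2 := norm_add_le (shapeMap q - unitShape - shapeDeriv (q - unitShape))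
    (shapeDeriv (q - unitShape))
  rw [sub_add_cancel] at h2
  linarith

theorem stepMatrix_unitShape : stepMatrix unitShape = 1 := by
  rw [stepMatrix, coeffMatrix_unitShape, ← Nat.cast_smul_eq_nsmul ℝ, smul_smul, smul_smul,
    Matrix.det_smul]
  norm_num

theorem differentiableAt_stepMatrix (a b : Fin 3) :
    DifferentiableAt ℝ (fun q => stepMatrix q a b) unitShape := by
  have h := differentiableAt_coeffMatrix
  have hd : DifferentiableAt ℝ (fun q => (coeffMatrix (edgeRatio q)).det) unitShape := by
    simp only [Matrix.det_fin_three]; fun_prop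
  have hp := det_coeffMatrix_pos (edgeRatio unitShape) fun _ _ => Real.sqrt_nonneg _
  simp only [stepMatrix, Matrix.smul_apply, smul_eq_mul, one_div]
  refine DifferentiableAt.fun_mul (DifferentiableAt.rpow_const ?_ (Or.inl ?_))
    ((h a b).const_mul _)
  · exact (hd.const_mul _).fun_inv (by positivity)
  · positivity

theorem eventually_stepMatrix_le : ∃ K : ℝ, 0 < K ∧ ∀ᶠ q in nhds unitShape, ∀ a b,
    |stepMatrix q a b - (1 : Matrix (Fin 3) (Fin 3) ℝ) a b| ≤ K * ‖q - unitShape‖ := by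
  have h (a b : Fin 3) := (differentiableAt_stepMatrix a b).hasFDerivAt.isBigO_sub.bound
  simp only [stepMatrix_unitShape, Real.norm_eq_abs] at h
  choose c hc using h
  -- The sum dominates all nine constants at once; the extra 1 makes it positive.
  refine ⟨1 + ∑ a, ∑ b, |c a b|, by positivity, ?_⟩
  have hc' : ∀ᶠ q in nhds unitShape, ∀ a b,
      |stepMatrix q a b - (1 : Matrix (Fin 3) (Fin 3) ℝ) a b| ≤ c a b * ‖q - unitShape‖ :=
    Filter.eventually_all.2 fun a => Filter.eventually_all.2 fun b => hc a b
  filter_upwards [hc'] with q hq a b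
  refine (hq a b).trans (mul_le_mul_of_nonneg_right ?_ (norm_nonneg _))
  have h1 : |c a b| ≤ ∑ b, |c a b| :=
    Finset.single_le_sum (f := fun b => |c a b|) (fun _ _ => abs_nonneg _) (Finset.mem_univ b)
  have h2 : ∑ b, |c a b| ≤ ∑ a, ∑ b, |c a b| :=
    Finset.single_le_sum (f := fun a => ∑ b, |c a b|) (fun _ _ => by positivity)
      (Finset.mem_univ a)
  linarith [le_abs_self (c a b)]

/-! ### Continuity -/

theorem continuous_sqEdge : Continuous fun x : Tet => sqEdge x.1 := by
  refine (PiLp.continuous_toLp 2 _).comp (continuous_pi fun e => ?_)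
  have h (i j : Fin 3) : Continuous fun x : Tet => x.1 i j := by fun_prop
  have hv (i : Fin 4) : Continuous fun x : Tet => vertex x.1 i := by
    fin_cases i
    · exact continuous_const
    all_goals exact (PiLp.continuous_toLp 2 _).comp (continuous_pi fun i => h i _)
  exact ((hv _).dist (hv _)).pow 2

theorem continuous_shape : Continuous shape := by
  have h (e : Fin 6) : Continuous fun x : Tet => sqEdge x.1 e :=
    (EuclideanSpace.proj (𝕜 := ℝ) e).continuous.comp continuous_sqEdge
  have ht : Continuous fun x : Tet => total (sqEdge x.1) := by unfold total; fun_prop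
  exact (continuous_const.div ht fun x => (total_sqEdge_pos x).ne').smul continuous_sqEdge

theorem continuous_ratio : Continuous fun x : Tet => ratio x.1 := by
  have h (e : Fin 6) : Continuous fun x : Tet => sqEdge x.1 e :=
    (EuclideanSpace.proj (𝕜 := ℝ) e).continuous.comp continuous_sqEdge
  have hm (i : Fin 4) (j : Fin 3) : Continuous fun x : Tet => medianSq (sqEdge x.1) i j := by
    unfold medianSq; fun_prop
  simp only [ratio_eq_edgeRatio]
  exact continuous_pi fun i => continuous_pi fun j =>
    ((hm i (j - 1)).div (hm i j) fun x => (medianSq_pos x i j).ne').sqrt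

theorem continuous_coeffMatrix : Continuous coeffMatrix := by
  refine continuous_matrix fun a b => ?_
  fin_cases a <;> fin_cases b <;> simp [coeffMatrix] <;> fun_prop

theorem continuous_Theta : Continuous Theta := by
  have hi := (Matrix.SpecialLinearGroup.isClosedEmbedding_val (n := Fin 3) (R := ℝ)).isInducing
  refine hi.continuous_iff.2 ?_
  have h : ((fun x : Tet => x.1) ∘ Theta) = fun x =>
      x.1 * ((1 / ((1 / 9) ^ 3 * (coeffMatrix (ratio x.1)).det)) ^ (1 / 3 : ℝ) •
        (1 / 9 : ℝ) • coeffMatrix (ratio x.1)) := by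
    ext1 x
    rw [← edgeRatio_shape]
    exact Theta_val x
  refine Eq.subst (motive := Continuous) h.symm ?_
  have hc : Continuous fun x : Tet => coeffMatrix (ratio x.1) :=
    continuous_coeffMatrix.comp continuous_ratio
  have hp (x : Tet) := det_coeffMatrix_pos (ratio x.1) (ratio_nonneg x.1)
  refine continuous_subtype_val.mul (Continuous.smul (Continuous.rpow_const ?_ fun x => ?_)
    (hc.fun_const_smul _))
  · exact continuous_const.div (continuous_const.mul hc.matrix_det) fun x =>
      (mul_pos (by norm_num) (hp x)).ne'
  · have := hp x
    exact Or.inl (by positivity)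

/-! ### Regular tetrahedra, Gram matrices and the `SO(3)` orbit -/

theorem shape_eq_unitShape_iff (x : Tet) :
    shape x = unitShape ↔ ∀ e, sqEdge x.1 e = total (sqEdge x.1) / 6 := by
  have ht := total_sqEdge_pos x
  have key (e : Fin 6) : shape x e = 1 ↔ sqEdge x.1 e = total (sqEdge x.1) / 6 := by
    rw [shape, normalize, PiLp.smul_apply, smul_eq_mul]
    constructor
    · intro h; field_simp at h ⊢; linarith
    · intro h; rw [h]; field_simp
  refine ⟨fun h e => (key e).1 (by rw [h]; rfl), fun h => ?_⟩
  ext e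
  exact (key e).2 (h e)

theorem isRegularTet_iff (x : Tet) : IsRegularTet x ↔ shape x = unitShape := by
  rw [shape_eq_unitShape_iff]
  have hne : ∀ e, (edge e).1 ≠ (edge e).2 := by decide
  have hex : ∀ i j, i ≠ j → ∃ e, edge e = (i, j) ∨ edge e = (j, i) := by decide
  constructor
  · intro h e
    have h' (e') : sqEdge x.1 e' = sqEdge x.1 e := by
      rw [sqEdge_apply, sqEdge_apply, h _ _ _ _ (hne e') (hne e)]
    simp only [total, h' 0, h' 1, h' 2, h' 3, h' 4, h' 5]
    ring
  · intro h
    have key (i j : Fin 4) (hij : i ≠ j) :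
        dist (vertex x.1 i) (vertex x.1 j) ^ 2 = total (sqEdge x.1) / 6 := by
      obtain ⟨e, he | he⟩ := hex i j hij
      · rw [← h e, sqEdge_apply, he]
      · rw [← h e, sqEdge_apply, he, dist_comm]
    intro i j k l hij hkl
    exact (sq_eq_sq₀ dist_nonneg dist_nonneg).1 ((key i j hij).trans (key k l hkl).symm)

theorem gram_apply (x : Matrix (Fin 3) (Fin 3) ℝ) (a b : Fin 3) :
    (x.transpose * x) a b = x 0 a * x 0 b + x 1 a * x 1 b + x 2 a * x 2 b := by
  simp [Matrix.mul_apply, Fin.sum_univ_three]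

theorem sqEdge_congr {x y : Matrix (Fin 3) (Fin 3) ℝ}
    (h : x.transpose * x = y.transpose * y) : sqEdge x = sqEdge y := by
  have h' (a b : Fin 3) := congrFun₂ h a b
  simp only [gram_apply] at h'
  ext e
  rw [sqEdge_eq, sqEdge_eq]
  fin_cases e <;> simp
  · linarith [h' 0 0]
  · linarith [h' 1 1]
  · linarith [h' 2 2]
  · linarith [h' 0 0, h' 1 1, h' 0 1]
  · linarith [h' 0 0, h' 2 2, h' 0 2]
  · linarith [h' 1 1, h' 2 2, h' 1 2]

/-- Polarization gives the Gram matrix. The displayed matrix has determinant 1/2 and the Gram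
determinant is 1, which forces `c ^ 3 = 2`: unit volume fixes the edge length. -/
theorem gram_of_shape_eq {x : Tet} (h : shape x = unitShape) :
    ∃ c : ℝ, c ^ 3 = 2 ∧ x.1.transpose * x.1 = c • !![1, 1/2, 1/2; 1/2, 1, 1/2; 1/2, 1/2, 1] := by
  rw [shape_eq_unitShape_iff] at h
  obtain ⟨c, h⟩ : ∃ c, ∀ e, sqEdge x.1 e = c := ⟨_, h⟩
  rw [sqEdge_eq] at h
  have hg : x.1.transpose * x.1 = c • !![1, 1/2, 1/2; 1/2, 1, 1/2; 1/2, 1/2, 1] := by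
    have h0 := h 0
    have h1 := h 1
    have h2 := h 2
    have h3 := h 3
    have h4 := h 4
    have h5 := h 5
    simp only [Matrix.cons_val] at h0 h1 h2 h3 h4 h5
    ext a b
    rw [gram_apply]
    fin_cases a <;> fin_cases b <;> simp <;> linarith
  refine ⟨c, ?_, hg⟩
  have hd := congrArg Matrix.det hg
  rw [Matrix.det_mul, Matrix.det_transpose, x.2, Matrix.det_smul, Matrix.det_fin_three] at hd
  simp only [Matrix.of_apply, Matrix.cons_val', Matrix.cons_val_zero,
    Matrix.cons_val_one, Matrix.cons_val_fin_one, Matrix.cons_val, Fintype.card_fin] at hd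
  linarith

theorem gram_eq_of_regular {x y : Tet} (hx : shape x = unitShape) (hy : shape y = unitShape) :
    x.1.transpose * x.1 = y.1.transpose * y.1 := by
  obtain ⟨c, hc, hxc⟩ := gram_of_shape_eq hx
  obtain ⟨d, hd, hyd⟩ := gram_of_shape_eq hy
  have : c = d := (Odd.strictMono_pow (R := ℝ) (n := 3) (by decide)).injective (hc.trans hd.symm)
  rw [hxc, hyd, this]

theorem mem_orbitSO_iff (x y : Tet) :
    y ∈ orbitSO x ↔ y.1.transpose * y.1 = x.1.transpose * x.1 := by
  constructor
  · rintro ⟨ρ, hρ, h⟩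
    have ho := (Matrix.mem_specialOrthogonalGroup_iff.1 hρ).1
    rw [Matrix.mem_orthogonalGroup_iff'] at ho
    rw [h, Matrix.transpose_mul, Matrix.mul_assoc, ← Matrix.mul_assoc ρ.transpose]
    erw [ho]
    rw [Matrix.one_mul]
  · intro h
    have hu : IsUnit x.1.det := by rw [x.2]; exact isUnit_one
    -- Equal Gram matrices make `y * x⁻¹` orthogonal; its determinant is 1 because both tetrahedra
    -- have determinant 1.
    refine ⟨y.1 * x.1⁻¹, ?_, by rw [Matrix.mul_assoc, Matrix.nonsing_inv_mul _ hu, Matrix.mul_one]⟩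
    rw [Matrix.mem_specialOrthogonalGroup_iff, Matrix.mem_orthogonalGroup_iff']
    constructor
    · change (y.1 * x.1⁻¹).transpose * (y.1 * x.1⁻¹) = 1
      rw [Matrix.transpose_mul, Matrix.mul_assoc, ← Matrix.mul_assoc y.1.transpose, h,
        Matrix.mul_assoc, Matrix.mul_nonsing_inv _ hu, Matrix.mul_one, ← Matrix.transpose_mul,
        Matrix.mul_nonsing_inv _ hu, Matrix.transpose_one]
    · rw [Matrix.det_mul, Matrix.det_nonsing_inv, x.2, y.2]; simp

theorem mem_orbitSO_iff_shape {x : Tet} (hx : shape x = unitShape) (y : Tet) :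
    y ∈ orbitSO x ↔ shape y = unitShape := by
  rw [mem_orbitSO_iff]
  refine ⟨fun h => ?_, fun hy => gram_eq_of_regular hy hx⟩
  rw [shape, sqEdge_congr h, ← shape, hx]

/-- A Gram fibre is closed, and its entries are bounded by the diagonal of the Gram matrix, the
squared column norms. -/
theorem isCompact_orbitSO (x : Tet) : IsCompact (orbitSO x) := by
  have hs : orbitSO x = Subtype.val ⁻¹' {m : Matrix (Fin 3) (Fin 3) ℝ |
      m.transpose * m = x.1.transpose * x.1} := by
    ext y; exact mem_orbitSO_iff x y
  rw [hs]
  refine Matrix.SpecialLinearGroup.isClosedEmbedding_val.isCompact_preimage ?_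
  have hb (a : Fin 3) : ∃ c : ℝ, ∀ m : Matrix (Fin 3) (Fin 3) ℝ,
      m.transpose * m = x.1.transpose * x.1 → ∀ i, |m i a| ≤ c := by
    refine ⟨√((x.1.transpose * x.1) a a), fun m hm i => Real.abs_le_sqrt ?_⟩
    rw [← hm, gram_apply]
    fin_cases i <;> simp <;> nlinarith [sq_nonneg (m 0 a), sq_nonneg (m 1 a), sq_nonneg (m 2 a)]
  choose c hc using hb
  have hK : IsCompact (Set.univ.pi fun _ : Fin 3 => Set.univ.pi fun a : Fin 3 =>
      Set.Icc (-c a) (c a)) :=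
    isCompact_univ_pi fun _ => isCompact_univ_pi fun _ => isCompact_Icc
  refine hK.of_isClosed_subset
    (isClosed_eq (continuous_id.matrix_transpose.mul continuous_id) continuous_const) ?_
  intro m hm i _ a _
  exact abs_le.1 (hc a m hm i)

theorem Theta_eq_self {x : Tet} (hx : shape x = unitShape) : Theta x = x := by
  apply Subtype.ext
  rw [Theta_val, hx, stepMatrix_unitShape, Matrix.mul_one]

/-! ### Infinite products and convergence of the iterates -/

/-- Rows stay bounded in the ℓ¹ norm, so consecutive terms differ by a geometric sequence and each
entry is Cauchy. -/
theorem exists_tendsto_of_mul_near_one {κ : ℝ} (h0 : 0 ≤ κ) (h1 : κ < 1)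
    {y B : ℕ → Matrix (Fin 3) (Fin 3) ℝ} (hy : ∀ n, y (n + 1) = y n * B n)
    (hB : ∀ n a b, |B n a b - (1 : Matrix (Fin 3) (Fin 3) ℝ) a b| ≤ (1 - κ) / 6 * κ ^ n) :
    ∃ l, Filter.Tendsto y Filter.atTop (nhds l) := by
  have step (n : ℕ) (a b : Fin 3) :
      |y (n + 1) a b - y n a b| ≤ (∑ c, |y n a c|) * ((1 - κ) / 6 * κ ^ n) := by
    have e : y (n + 1) a b - y n a b =
        ∑ c, y n a c * (B n c b - (1 : Matrix (Fin 3) (Fin 3) ℝ) c b) := by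
      conv_lhs => rw [hy, ← Matrix.mul_one (y n), Matrix.mul_assoc, Matrix.one_mul]
      simp only [Matrix.mul_apply, ← Finset.sum_sub_distrib, mul_sub]
    rw [e, Finset.sum_mul]
    refine (Finset.abs_sum_le_sum_abs _ _).trans (Finset.sum_le_sum fun c _ => ?_)
    rw [abs_mul]
    exact mul_le_mul_of_nonneg_left (hB n c b) (abs_nonneg _)
  -- The three columns turn the factor 1/6 into 1/2, and `(2 - κ^n) * (1 + (1 - κ)/2 * κ^n) ≤ 2 -
  -- κ^(n+1)`, so this bound propagates.
  have bound (n : ℕ) (a : Fin 3) : ∑ c, |y n a c| ≤ (∑ c, |y 0 a c|) * (2 - κ ^ n) := by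
    induction n with
    | zero => norm_num
    | succ n ih =>
      have hκ : 0 ≤ κ ^ n := pow_nonneg h0 n
      have hr : 0 ≤ ∑ c, |y 0 a c| := by positivity
      have h2 : ∑ c, |y (n + 1) a c| ≤ (∑ c, |y n a c|) * (1 + (1 - κ) / 2 * κ ^ n) := by
        have (c : Fin 3) : |y (n + 1) a c| ≤
            |y n a c| + (∑ c, |y n a c|) * ((1 - κ) / 6 * κ ^ n) := by
          have := abs_add_le (y n a c) (y (n + 1) a c - y n a c)
          rw [add_sub_cancel] at this
          linarith [step n a c]
        refine (Finset.sum_le_sum fun c _ => this c).trans_eq ?_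
        simp only [Fin.sum_univ_three]
        ring
      refine h2.trans ?_
      have h3 : 0 ≤ 1 + (1 - κ) / 2 * κ ^ n := by
        have : 0 ≤ (1 - κ) / 2 := by linarith
        positivity
      refine (mul_le_mul_of_nonneg_right ih h3).trans ?_
      rw [mul_assoc]
      refine mul_le_mul_of_nonneg_left ?_ hr
      rw [pow_succ]
      nlinarith [mul_nonneg (mul_nonneg hκ hκ) (sub_nonneg.2 h1.le)]
  have entry (a b : Fin 3) : ∃ l, Filter.Tendsto (fun n => y n a b) Filter.atTop (nhds l) := by
    refine cauchySeq_tendsto_of_complete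
      (cauchySeq_of_le_geometric κ ((∑ c, |y 0 a c|) * 2 * ((1 - κ) / 6)) h1 fun n => ?_)
    rw [dist_comm, Real.dist_eq]
    refine (step n a b).trans ?_
    have hκ : 0 ≤ κ ^ n := pow_nonneg h0 n
    have hr : 0 ≤ ∑ c, |y 0 a c| := by positivity
    have h6 : 0 ≤ (1 - κ) / 6 := by linarith
    rw [mul_assoc _ ((1 - κ) / 6)]
    refine mul_le_mul_of_nonneg_right ((bound n a).trans ?_) (by positivity)
    exact mul_le_mul_of_nonneg_left (by linarith) hr
  choose l hl using entry
  exact ⟨Matrix.of l, tendsto_pi_nhds.2 fun a => tendsto_pi_nhds.2 fun b => hl a b⟩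

theorem shape_Theta_eq (x : Tet) : shape (Theta x) = shapeMap (shape x) := shape_Theta x

/-- The tetrahedra whose shape is close to that of the regular ones. -/
def nearRegular (ε : ℝ) : Set Tet := {x | ‖shape x - unitShape‖ < ε}

theorem isOpen_nearRegular (ε : ℝ) : IsOpen (nearRegular ε) :=
  isOpen_lt (continuous_shape.sub continuous_const).norm continuous_const

theorem exists_contraction : ∃ ε > 0,
    (∀ x ∈ nearRegular ε, ‖shape (Theta x) - unitShape‖ ≤ 19 / 20 * ‖shape x - unitShape‖) ∧
    ∃ K > 0, ∀ x ∈ nearRegular ε, ∀ a b,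
      |stepMatrix (shape x) a b - (1 : Matrix (Fin 3) (Fin 3) ℝ) a b| ≤
        K * ‖shape x - unitShape‖ := by
  obtain ⟨K, hK, h⟩ := eventually_stepMatrix_le
  obtain ⟨ε, hε, hb⟩ := Metric.eventually_nhds_iff.1 (eventually_shapeMap_contracts.and h)
  refine ⟨ε, hε, fun x hx => ?_, K, hK, fun x hx => (hb (by rwa [dist_eq_norm])).2⟩
  rw [shape_Theta_eq]
  exact (hb (by rwa [dist_eq_norm])).1 (total_shape x)

theorem nearRegular_mono {ε δ : ℝ} (h : ε ≤ δ) : nearRegular ε ⊆ nearRegular δ :=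
  fun _ hx => lt_of_lt_of_le hx h

theorem iterate_contracts {ε : ℝ} (h : ∀ x ∈ nearRegular ε,
    ‖shape (Theta x) - unitShape‖ ≤ 19 / 20 * ‖shape x - unitShape‖) {x : Tet}
    (hx : x ∈ nearRegular ε) (n : ℕ) :
    Theta^[n] x ∈ nearRegular ε ∧
      ‖shape (Theta^[n] x) - unitShape‖ ≤ (19 / 20) ^ n * ‖shape x - unitShape‖ := by
  induction n with
  | zero => exact ⟨hx, by simp⟩
  | succ n ih =>
    obtain ⟨h1, h2⟩ := ih
    rw [Function.iterate_succ_apply']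
    have h3 := h _ h1
    refine ⟨?_, ?_⟩
    · change _ < ε
      have : ‖shape (Theta^[n] x) - unitShape‖ < ε := h1
      linarith [norm_nonneg (shape (Theta^[n] x) - unitShape)]
    · rw [pow_succ]; linarith

theorem isLocalAttractor_Theta {xeq : Tet} (hx : shape xeq = unitShape) :
    IsLocalAttractor Theta (orbitSO xeq) := by
  obtain ⟨ε, hε, h, -⟩ := exists_contraction
  have hA (y : Tet) := mem_orbitSO_iff_shape hx y
  have hsub : orbitSO xeq ⊆ nearRegular ε := fun y hy => by
    change ‖_‖ < ε
    rw [(hA y).1 hy, sub_self, norm_zero]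
    exact hε
  refine ⟨continuous_Theta, isCompact_orbitSO xeq, ?_, nearRegular ε, isOpen_nearRegular ε, hsub,
    ?_, ?_⟩
  · rintro _ ⟨y, hy, rfl⟩
    rwa [Theta_eq_self ((hA y).1 hy)]
  · rintro _ ⟨y, hy, rfl⟩
    exact (iterate_contracts h hy 1).1
  · refine Set.Subset.antisymm (fun y hy => ?_) (fun y hy => ?_)
    · rw [hA, ← sub_eq_zero, ← norm_le_zero_iff]
      have hlim : Filter.Tendsto (fun n : ℕ => (19 / 20 : ℝ) ^ n * ε) Filter.atTop (nhds 0) := by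
        simpa using (tendsto_pow_atTop_nhds_zero_of_lt_one (by norm_num : (0 : ℝ) ≤ 19 / 20)
          (by norm_num)).mul_const ε
      -- The preimage `z` varies with `n`, so the estimate must be uniform over the neighbourhood;
      -- hence `ε` in the bound.
      refine ge_of_tendsto' hlim fun n => ?_
      obtain ⟨z, hz, rfl⟩ := Set.mem_iInter.1 hy n
      refine (iterate_contracts h hz n).2.trans ?_
      exact mul_le_mul_of_nonneg_left (le_of_lt hz) (by positivity)
    · refine Set.mem_iInter.2 fun n => ⟨y, hsub hy, ?_⟩
      exact Function.iterate_fixed (Theta_eq_self ((hA y).1 hy)) n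

theorem exists_nhds_tendsto {xeq : Tet} (hx : shape xeq = unitShape) :
    ∃ U : Set Tet, IsOpen U ∧ orbitSO xeq ⊆ U ∧ ∀ x ∈ U, ∃ xstar ∈ orbitSO xeq,
      IsRegularTet xstar ∧
        Filter.Tendsto (fun n : ℕ => Theta^[n] x) Filter.atTop (nhds xstar) := by
  obtain ⟨ε, hε, h, K, hK, hstep⟩ := exists_contraction
  -- With `κ = 19/20`, `(1 - κ) / 6 = 1/120`; this radius makes `K` times the initial deviation at
  -- most that.
  have hpos : 0 < min ε (1 / (120 * K)) := by positivity
  refine ⟨nearRegular (min ε (1 / (120 * K))), isOpen_nearRegular _, fun y hy => ?_,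
    fun x hxU => ?_⟩
  · change ‖_‖ < _
    rw [(mem_orbitSO_iff_shape hx y).1 hy, sub_self, norm_zero]
    exact hpos
  have hxε : x ∈ nearRegular ε := nearRegular_mono (min_le_left _ _) hxU
  have hxK : ‖shape x - unitShape‖ ≤ 1 / (120 * K) := (lt_of_lt_of_le hxU (min_le_right _ _)).le
  have hit := iterate_contracts h hxε
  obtain ⟨l, hl⟩ := exists_tendsto_of_mul_near_one (κ := 19 / 20) (by norm_num) (by norm_num)
    (y := fun n => (Theta^[n] x).1) (B := fun n => stepMatrix (shape (Theta^[n] x)))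
    (fun n => by rw [Function.iterate_succ_apply', Theta_val]) (fun n a b => by
      refine (hstep _ (hit n).1 a b).trans ?_
      have h2 : ‖shape (Theta^[n] x) - unitShape‖ ≤ (19 / 20) ^ n * (1 / (120 * K)) :=
        (hit n).2.trans (mul_le_mul_of_nonneg_left hxK (by positivity))
      refine (mul_le_mul_of_nonneg_left h2 hK.le).trans_eq ?_
      field_simp
      norm_num)
  have hdet : l.det = 1 := by
    have hd := ((continuous_id.matrix_det (n := Fin 3) (R := ℝ)).tendsto l).comp hl
    refine tendsto_nhds_unique hd ?_
    refine tendsto_const_nhds.congr fun n => ?_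
    exact (Theta^[n] x).2.symm
  let xs : Tet := ⟨l, hdet⟩
  have hxs : Filter.Tendsto (fun n : ℕ => Theta^[n] x) Filter.atTop (nhds xs) :=
    (Matrix.SpecialLinearGroup.isClosedEmbedding_val (n := Fin 3)
      (R := ℝ)).isInducing.tendsto_nhds_iff.2 hl
  have hshape : shape xs = unitShape := by
    have h1 := (continuous_shape.tendsto xs).comp hxs
    refine tendsto_nhds_unique h1 ?_
    rw [tendsto_iff_norm_sub_tendsto_zero]
    have hlim : Filter.Tendsto (fun n : ℕ => (19 / 20 : ℝ) ^ n * ‖shape x - unitShape‖)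
        Filter.atTop (nhds 0) := by
      simpa using (tendsto_pow_atTop_nhds_zero_of_lt_one (by norm_num : (0 : ℝ) ≤ 19 / 20)
        (by norm_num)).mul_const ‖shape x - unitShape‖
    exact squeeze_zero (fun _ => norm_nonneg _) (fun n => (hit n).2) hlim
  exact ⟨xs, (mem_orbitSO_iff_shape hx xs).2 hshape, (isRegularTet_iff xs).2 hshape, hxs⟩

/-! ### The orbit as a smooth submanifold -/

theorem gram_eq_of_sqEdge_eq {x y : Matrix (Fin 3) (Fin 3) ℝ} (h : sqEdge x = sqEdge y) :
    x.transpose * x = y.transpose * y := by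
  have h' (e : Fin 6) := congrArg (fun v : EdgeSpace => v e) h
  simp only [sqEdge_eq] at h'
  have h0 := h' 0
  have h1 := h' 1
  have h2 := h' 2
  have h3 := h' 3
  have h4 := h' 4
  have h5 := h' 5
  simp only [Matrix.cons_val] at h0 h1 h2 h3 h4 h5
  ext a b
  rw [gram_apply, gram_apply]
  fin_cases a <;> fin_cases b <;> simp <;> linarith

theorem contDiff_sqEdge :
    ContDiff ℝ ∞ fun m : Fin 3 → Fin 3 → ℝ => sqEdge (Matrix.of m) := by
  rw [contDiff_euclidean]
  intro e
  simp only [sqEdge_eq, Matrix.of_apply]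
  fin_cases e <;> simp only [Fin.zero_eta, Fin.mk_one, Fin.reduceFinMk, Matrix.cons_val] <;>
    fun_prop

theorem hasDerivAt_sqEdge (m h : Matrix (Fin 3) (Fin 3) ℝ) (e : Fin 6) :
    HasDerivAt (fun t : ℝ => sqEdge (m + t • h) e)
      (let s := m.transpose * h
       ![2 * s 0 0, 2 * s 1 1, 2 * s 2 2,
        2 * (s 0 0 - s 0 1 - s 1 0 + s 1 1), 2 * (s 0 0 - s 0 2 - s 2 0 + s 2 2),
        2 * (s 1 1 - s 1 2 - s 2 1 + s 2 2)] e) 0 := by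
  have hl (a b : ℝ) : HasDerivAt (fun t : ℝ => a + t * b) b 0 := by
    simpa using ((hasDerivAt_id (0 : ℝ)).mul_const b).const_add a
  have hd (k : Fin 3) := ((((hl (m 0 k) (h 0 k)).pow 2).add ((hl (m 1 k) (h 1 k)).pow 2)).add
    ((hl (m 2 k) (h 2 k)).pow 2))
  have hdd (k l : Fin 3) := (((((hl (m 0 k) (h 0 k)).sub (hl (m 0 l) (h 0 l))).pow 2).add
    (((hl (m 1 k) (h 1 k)).sub (hl (m 1 l) (h 1 l))).pow 2)).add
    (((hl (m 2 k) (h 2 k)).sub (hl (m 2 l) (h 2 l))).pow 2))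
  simp only [sqEdge_eq]
  fin_cases e
  · refine (hd 0).congr_deriv ?_
    simp [Matrix.mul_apply, Fin.sum_univ_three]; ring
  · refine (hd 1).congr_deriv ?_
    simp [Matrix.mul_apply, Fin.sum_univ_three]; ring
  · refine (hd 2).congr_deriv ?_
    simp [Matrix.mul_apply, Fin.sum_univ_three]; ring
  · refine (hdd 0 1).congr_deriv ?_
    simp [Matrix.mul_apply, Fin.sum_univ_three]; ring
  · refine (hdd 0 2).congr_deriv ?_
    simp [Matrix.mul_apply, Fin.sum_univ_three]; ring
  · refine (hdd 1 2).congr_deriv ?_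
    simp [Matrix.mul_apply, Fin.sum_univ_three]; ring

/-- The derivative in direction `h` depends only on `mᵀ * h`, which can be any matrix since `m` is
invertible; six squared-edge variations prescribe a symmetric one. -/
theorem surjective_fderiv_sqEdge (q : EdgeSpace) {m : Fin 3 → Fin 3 → ℝ}
    (hm : 0 < (Matrix.of m).det) : Function.Surjective
      (fderiv ℝ (fun m : Fin 3 → Fin 3 → ℝ => sqEdge (Matrix.of m) - q) m) := by
  intro s
  have hu : IsUnit (Matrix.of m).transpose.det := by
    rw [Matrix.det_transpose]; exact hm.ne'.isUnit
  -- Half the Gram variation obtained from `s` by polarization, since a symmetric `mᵀ * h` varies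
  -- the Gram matrix by twice itself.
  let S : Matrix (Fin 3) (Fin 3) ℝ := !![s 0 / 2, (s 0 + s 1 - s 3) / 4, (s 0 + s 2 - s 4) / 4;
    (s 0 + s 1 - s 3) / 4, s 1 / 2, (s 1 + s 2 - s 5) / 4;
    (s 0 + s 2 - s 4) / 4, (s 1 + s 2 - s 5) / 4, s 2 / 2]
  let H : Matrix (Fin 3) (Fin 3) ℝ := (Matrix.of m).transpose⁻¹ * S
  have hH : (Matrix.of m).transpose * H = S := by
    rw [← Matrix.mul_assoc, Matrix.mul_nonsing_inv _ hu, Matrix.one_mul]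
  let H' : Fin 3 → Fin 3 → ℝ := fun i j => H i j
  refine ⟨H', ?_⟩
  have hl : HasDerivAt (fun t : ℝ => m + t • H') H' 0 := by
    simpa using ((hasDerivAt_id (0 : ℝ)).smul_const H').const_add m
  have hf : DifferentiableAt ℝ (fun m : Fin 3 → Fin 3 → ℝ => sqEdge (Matrix.of m) - q) m :=
    (contDiff_sqEdge.sub contDiff_const).differentiable (by simp) m
  have hd : HasFDerivAt (fun m : Fin 3 → Fin 3 → ℝ => sqEdge (Matrix.of m) - q)
      (fderiv ℝ (fun m : Fin 3 → Fin 3 → ℝ => sqEdge (Matrix.of m) - q) m)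
      (m + (0 : ℝ) • H') := by
    simpa using hf.hasFDerivAt
  have h := hd.comp_hasDerivAt 0 hl
  ext e
  have he := (EuclideanSpace.proj (𝕜 := ℝ) e).hasFDerivAt.comp_hasDerivAt 0 h
  refine he.unique (((hasDerivAt_sqEdge (Matrix.of m) H e).sub_const (q e)).congr_deriv ?_)
  rw [hH]
  fin_cases e <;> simp [S] <;> ring

theorem isSmoothSubmanifold_orbitSO (x : Tet) :
    IsSmoothSubmanifold 3 (toArray '' orbitSO x) := by
  refine ⟨6, by simp [Module.finrank_pi_fintype], ?_⟩
  rintro _ ⟨y, hy, rfl⟩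
  -- The edge equations already force `det² = 1`; positivity of the determinant excludes the mirror
  -- images, so no separate equation for `det = 1` is needed and the codimension is 6.
  refine ⟨{m | 0 < (Matrix.of m).det}, ?_, ?_, fun m => sqEdge (Matrix.of m) - sqEdge x.1,
    (contDiff_sqEdge.sub contDiff_const).contDiffOn,
    fun q hq => surjective_fderiv_sqEdge _ hq.2, ?_⟩
  · exact isOpen_lt continuous_const (Continuous.matrix_det continuous_id)
  · change 0 < y.1.det
    rw [y.2]; exact one_pos
  · ext m
    constructor
    · rintro ⟨⟨z, hz, rfl⟩, hm⟩
      refine ⟨hm, sub_eq_zero.2 (sqEdge_congr ?_)⟩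
      exact (mem_orbitSO_iff x z).1 hz
    · rintro ⟨hm, h0⟩
      have hg := gram_eq_of_sqEdge_eq (sub_eq_zero.1 h0)
      have hd := congrArg Matrix.det hg
      rw [Matrix.det_mul, Matrix.det_mul, Matrix.det_transpose, Matrix.det_transpose, x.2] at hd
      have hm' : 0 < (Matrix.of m).det := hm
      have h1 : (Matrix.of m).det = 1 := by nlinarith
      exact ⟨⟨⟨Matrix.of m, h1⟩, (mem_orbitSO_iff x _).2 hg, rfl⟩, hm⟩

end Tetra

theorem lemma4p1 (xeq : Tetra.Tet) (hreg : Tetra.IsRegularTet xeq) :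
    Tetra.IsLocalAttractor Tetra.Theta (Tetra.orbitSO xeq) ∧
    Tetra.IsSmoothSubmanifold 3 (Tetra.toArray '' Tetra.orbitSO xeq) ∧
    Tetra.Theta '' Tetra.orbitSO xeq = Tetra.orbitSO xeq ∧
    ∃ U : Set Tetra.Tet, IsOpen U ∧ Tetra.orbitSO xeq ⊆ U ∧
      ∀ x ∈ U, ∃ xstar ∈ Tetra.orbitSO xeq, Tetra.IsRegularTet xstar ∧
        Filter.Tendsto (fun n : ℕ => Tetra.Theta^[n] x) Filter.atTop (nhds xstar) := by
  have hx := (Tetra.isRegularTet_iff xeq).1 hreg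
  have hfix (y : Tetra.Tet) (hy : y ∈ Tetra.orbitSO xeq) : Tetra.Theta y = y :=
    Tetra.Theta_eq_self ((Tetra.mem_orbitSO_iff_shape hx y).1 hy)
  refine ⟨Tetra.isLocalAttractor_Theta hx, Tetra.isSmoothSubmanifold_orbitSO xeq, ?_,
    Tetra.exists_nhds_tendsto hx⟩
  rw [Set.image_congr hfix, Set.image_id']
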